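/- Let $\mathcal H$ be a separable complex Hilbert space. A density operator is a positive operator on $\mathcal H$ of trace $1$; let $\mathcal M$ be the set of density operators $\rho$ such that $\rho^p$ is of trace class for some $p\in(0,1)$. For a bounded operator $T$ let $\|T\|$ be the operator norm and $\|T\|_1=\operatorname{Tr}|T|\in[0,\infty]$ the trace norm. For a density operator $\rho$ with trivial kernel and bounded $X$, the Araki norm is $$\|X\|_A=\sup\{\|\rho^{t}X\rho^{-t}\| : t\in\mathbb C,\ |t|<1/2\}\in[0,\infty].$$ Theorem. Let $\rho\in\mathcal M$ be of the form $\rho=\rho_0=e^{-H_0-\Psi_0}$ with $H_0$ a (possibly unbounded) self-adjoint operator and $\Psi_0\in\mathbb R$, and let $X$ be a bounded self-adjoint operator. Then there is exactly one density operator $\sigma=\rho_X$ of the form $\rho_X=e^{-H_0-X-\Psi_X}$ with $\Psi_X\in\mathbb R$, it lies in $\mathcal M$, and $$\|\rho-\sigma\|_1\le\|X\|\le\|X\|_A .$$ In particular, the trace norm on states is weaker than the operator norm on perturbations, and hence weaker than the Araki norm. -/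

import Mathlib

open scoped ENNReal InnerProductSpace ComplexConjugate lp

noncomputable section

namespace QInfo

set_option linter.unusedSectionVars false

universe u

variable {H : Type u} [NormedAddCommGroup H] [InnerProductSpace ℂ H] [CompleteSpace H]

/-! ### Unbounded operators with an orthonormal eigenbasis, and their functional calculus -/

/-- The maximal domain `{x | ∑ ‖a i * ⟪b i, x⟫‖ ^ 2 < ∞}` of the operator that is diagonal in the
orthonormal basis `b` with eigenvalues `a i`. -/
def diagDomain {ι : Type*} (b : HilbertBasis ι ℂ H) (a : ι → ℂ) : Submodule ℂ H where
  carrier := {x | Memℓp (fun i => a i * b.repr x i) 2}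
  zero_mem' := by
    have h : (fun i => a i * b.repr (0 : H) i) = 0 := by funext i; simp
    show Memℓp (fun i => a i * b.repr (0 : H) i) 2
    rw [h]; exact zero_memℓp
  add_mem' := by
    intro x y hx hy
    have h : (fun i => a i * b.repr (x + y) i) =
        (fun i => a i * b.repr x i) + fun i => a i * b.repr y i := by
      funext i; simp [mul_add]
    show Memℓp (fun i => a i * b.repr (x + y) i) 2
    rw [h]; exact Memℓp.add hx hy
  smul_mem' := by
    intro c x hx
    have h : (fun i => a i * b.repr (c • x) i) = c • fun i => a i * b.repr x i := by
      funext i; simp [mul_left_comm]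
    show Memℓp (fun i => a i * b.repr (c • x) i) 2
    rw [h]; exact Memℓp.const_smul hx c

/-- The (in general unbounded) operator that is diagonal in the orthonormal basis `b` with
eigenvalues `a i`, on its maximal domain. -/
def diagOp {ι : Type*} (b : HilbertBasis ι ℂ H) (a : ι → ℂ) : H →ₗ.[ℂ] H where
  domain := diagDomain b a
  toFun :=
    { toFun := fun x => b.repr.symm ⟨fun i => a i * b.repr (x : H) i, x.2⟩
      map_add' := by
        intro x y
        rw [← map_add]
        congr 1
        apply Subtype.ext
        funext i
        show a i * b.repr ((x : H) + (y : H)) i = a i * b.repr (x : H) i + a i * b.repr (y : H) i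
        rw [map_add, lp.coeFn_add, Pi.add_apply, mul_add]
      map_smul' := by
        intro c x
        rw [RingHom.id_apply, ← map_smul]
        congr 1
        apply Subtype.ext
        funext i
        show a i * b.repr (c • (x : H)) i = c * (a i * b.repr (x : H) i)
        rw [map_smul, lp.coeFn_smul, Pi.smul_apply, smul_eq_mul, mul_left_comm] }

theorem mem_diagOp_domain {ι : Type*} (b : HilbertBasis ι ℂ H) (a : ι → ℂ) (x : H) :
    x ∈ (diagOp b a).domain ↔ Memℓp (fun i => a i * b.repr x i) 2 := Iff.rfl

theorem repr_diagOp {ι : Type*} (b : HilbertBasis ι ℂ H) (a : ι → ℂ) (x : (diagOp b a).domain)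
    (i : ι) : b.repr (diagOp b a x) i = a i * b.repr (x : H) i := by
  change b.repr (b.repr.symm ⟨fun i => a i * b.repr (x : H) i, x.2⟩) i = _
  rw [LinearIsometryEquiv.apply_symm_apply]

/-- `A` is self-adjoint with pure point spectrum: some orthonormal basis diagonalizes it, with real
eigenvalues. (If `exp (-A)` is trace class, the self-adjoint operator `A` is of this kind.) -/
def IsDiagonalizable (A : H →ₗ.[ℂ] H) : Prop :=
  ∃ (w : Set H) (b : HilbertBasis w ℂ H) (a : w → ℝ), A = diagOp b fun i => (a i : ℂ)

open Classical in
/-- The functional calculus `f(A)` for a self-adjoint operator `A` with an orthonormal eigenbasis: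
if `A b_i = a_i b_i`, then `f(A)` is the operator that is diagonal in `b` with eigenvalues `f a_i`,
on its maximal domain. It does not depend on the basis, see `spectralFun_diagOp`. For other `A` the
value is the operator with domain `{0}`. -/
def spectralFun (A : H →ₗ.[ℂ] H) (f : ℝ → ℂ) : H →ₗ.[ℂ] H :=
  if h : IsDiagonalizable A then
    diagOp h.choose_spec.choose fun i => f (h.choose_spec.choose_spec.choose i)
  else ⊥

theorem basis_mem_diagOp_domain {ι : Type*} (b : HilbertBasis ι ℂ H) (a : ι → ℂ) (j : ι) :
    b j ∈ (diagOp b a).domain := by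
  classical
  rw [mem_diagOp_domain]
  have h : (fun i => a i * b.repr (b j) i) = fun i => (lp.single 2 j (a j) : ℓ²(ι, ℂ)) i := by
    funext i
    rw [b.repr_self]
    by_cases hij : i = j
    · subst hij; simp
    · simp [hij]
  rw [h]
  exact lp.memℓp _

theorem diagOp_basis {ι : Type*} (b : HilbertBasis ι ℂ H) (a : ι → ℂ) (j : ι) :
    diagOp b a ⟨b j, basis_mem_diagOp_domain b a j⟩ = a j • b j := by
  classical
  apply b.repr.injective
  ext i
  rw [repr_diagOp]
  simp only [map_smul, b.repr_self]
  by_cases hij : i = j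
  · subst hij; simp
  · simp [hij]

theorem eigenvalue_eq {ι κ : Type*} {b : HilbertBasis ι ℂ H} {c : HilbertBasis κ ℂ H}
    {a : ι → ℂ} {d : κ → ℂ} (h : diagOp b a = diagOp c d) (i : ι) (j : κ)
    (hij : ⟪b i, c j⟫_ℂ ≠ 0) : a i = d j := by
  have hmem : c j ∈ (diagOp b a).domain := h ▸ basis_mem_diagOp_domain c d j
  have h1 : diagOp b a ⟨c j, hmem⟩ = d j • c j := by
    rw [← diagOp_basis c d j]
    apply (LinearPMap.ext_iff.1 h).2
  have h2 := repr_diagOp b a ⟨c j, hmem⟩ i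
  rw [h1] at h2
  simp only [map_smul, lp.coeFn_smul, Pi.smul_apply, smul_eq_mul, b.repr_apply_apply] at h2
  exact (mul_right_cancel₀ hij h2).symm

theorem diagOp_comp_le {ι κ : Type*} {b : HilbertBasis ι ℂ H} {c : HilbertBasis κ ℂ H}
    {a : ι → ℝ} {d : κ → ℝ} (h : (diagOp b fun i => (a i : ℂ)) = diagOp c fun j => (d j : ℂ))
    (f : ℝ → ℂ) : (diagOp b fun i => f (a i)) ≤ diagOp c fun j => f (d j) := by
  have key : ∀ (x : (diagOp b fun i => f (a i)).domain) (j : κ),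
      c.repr (diagOp b (fun i => f (a i)) x) j = f (d j) * c.repr (x : H) j := by
    intro x j
    rw [c.repr_apply_apply, c.repr_apply_apply, ← b.tsum_inner_mul_inner (c j),
      ← b.tsum_inner_mul_inner (c j) (x : H), ← tsum_mul_left]
    refine tsum_congr fun i => ?_
    rw [← b.repr_apply_apply, repr_diagOp, b.repr_apply_apply]
    by_cases hij : ⟪b i, c j⟫_ℂ = 0
    · have : ⟪c j, b i⟫_ℂ = 0 := inner_eq_zero_symm.1 hij
      simp [this]
    · have := eigenvalue_eq h i j hij
      rw [Complex.ofReal_inj.1 this]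
      ring
  have hdom : (diagOp b fun i => f (a i)).domain ≤ (diagOp c fun j => f (d j)).domain := by
    intro x hx
    rw [mem_diagOp_domain]
    have := lp.memℓp (c.repr (diagOp b (fun i => f (a i)) ⟨x, hx⟩))
    rwa [show (c.repr (diagOp b (fun i => f (a i)) ⟨x, hx⟩) : κ → ℂ) =
      fun j => f (d j) * c.repr x j from funext fun j => key ⟨x, hx⟩ j] at this
  refine ⟨hdom, ?_⟩
  intro x y hxy
  apply c.repr.injective
  ext j
  rw [key, repr_diagOp, hxy]

/-- The functional calculus may be computed in any orthonormal eigenbasis. -/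
theorem spectralFun_diagOp {ι : Type*} (b : HilbertBasis ι ℂ H) (a : ι → ℝ) (f : ℝ → ℂ) :
    spectralFun (diagOp b fun i => (a i : ℂ)) f = diagOp b fun i => f (a i) := by
  have hdiag : IsDiagonalizable (diagOp b fun i => (a i : ℂ)) := by
    have hinj : Function.Injective b := b.orthonormal.linearIndependent.injective
    let e : ι ≃ Set.range b := Equiv.ofInjective b hinj
    have hc : Orthonormal ℂ ((↑) : Set.range b → H) := b.orthonormal.toSubtypeRange
    have hsp : ⊤ ≤ (Submodule.span ℂ
        (Set.range ((↑) : Set.range b → H))).topologicalClosure := by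
      rw [Subtype.range_coe, b.dense_span]
    let c : HilbertBasis (Set.range b) ℂ H := HilbertBasis.mk hc hsp
    have hce : ∀ i, c (e i) = b i := by
      intro i
      simp [c, HilbertBasis.coe_mk, e]
    refine ⟨Set.range b, c, fun j => a (e.symm j), ?_⟩
    have hfun : ∀ (x : H) (i : ι), c.repr x (e i) = b.repr x i := by
      intro x i
      rw [c.repr_apply_apply, b.repr_apply_apply, hce]
    have hmem : ∀ x : H, Memℓp (fun i => (a i : ℂ) * b.repr x i) 2 ↔
        Memℓp (fun j => ((a (e.symm j) : ℝ) : ℂ) * c.repr x j) 2 := by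
      intro x
      rw [memℓp_gen_iff (by norm_num), memℓp_gen_iff (by norm_num), ← e.summable_iff]
      refine summable_congr fun i => ?_
      simp [hfun]
    refine LinearPMap.ext (Submodule.ext hmem) ?_
    intro x hx hx'
    apply b.repr.injective
    ext i
    have h1 := repr_diagOp b (fun i => (a i : ℂ)) ⟨x, hx⟩ i
    have h2 := repr_diagOp c (fun j => ((a (e.symm j) : ℝ) : ℂ)) ⟨x, hx'⟩ (e i)
    rw [hfun, hfun, e.symm_apply_apply] at h2
    exact h1.trans h2.symm
  unfold spectralFun
  rw [dif_pos hdiag]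
  have h := hdiag.choose_spec.choose_spec.choose_spec
  exact le_antisymm (diagOp_comp_le h.symm f) (diagOp_comp_le h f)

/-- A bounded operator, seen as an unbounded operator defined everywhere. -/
def ofBounded (T : H →L[ℂ] H) : H →ₗ.[ℂ] H := (T : H →ₗ[ℂ] H).toPMap ⊤

/-! ### Trace, Schatten classes, density operators -/

/-- The trace `∑ ⟪e_i, T e_i⟫` of a positive bounded operator, as an element of `[0, ∞]`; it does
not depend on the orthonormal basis, see `posTrace_eq_tsum`. -/
def posTrace (T : H →L[ℂ] H) : ℝ≥0∞ :=
  ∑' i : (exists_hilbertBasis ℂ H).choose,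
    ENNReal.ofReal (RCLike.re ⟪(i : H), T (i : H)⟫_ℂ)

theorem tsum_enorm_sq {ι : Type*} (b : HilbertBasis ι ℂ H) (x : H) :
    ∑' i, ‖⟪b i, x⟫_ℂ‖ₑ ^ 2 = ‖x‖ₑ ^ 2 := by
  have h := b.hasSum_inner_mul_inner x x
  have h1 : HasSum (fun i => ‖⟪b i, x⟫_ℂ‖ ^ 2) (‖x‖ ^ 2) := by
    have h2 := Complex.hasSum_re h
    have e1 : (⟪x, x⟫_ℂ).re = ‖x‖ ^ 2 := by
      rw [inner_self_eq_norm_sq_to_K]; norm_cast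
    have e2 : ∀ i, (⟪x, b i⟫_ℂ * ⟪b i, x⟫_ℂ).re = ‖⟪b i, x⟫_ℂ‖ ^ 2 := by
      intro i
      rw [← inner_conj_symm x (b i), ← Complex.normSq_eq_conj_mul_self, Complex.ofReal_re,
        Complex.normSq_eq_norm_sq]
    rw [e1] at h2
    simpa only [e2] using h2
  have h3 : ∀ y : H, ‖y‖ₑ ^ 2 = ENNReal.ofReal (‖y‖ ^ 2) := by
    intro y; rw [← ofReal_norm, ENNReal.ofReal_pow (norm_nonneg _)]
  have h4 : ∀ y : ℂ, ‖y‖ₑ ^ 2 = ENNReal.ofReal (‖y‖ ^ 2) := by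
    intro y; rw [← ofReal_norm, ENNReal.ofReal_pow (norm_nonneg _)]
  simp only [h3, h4]
  rw [← h1.tsum_eq, ENNReal.ofReal_tsum_of_nonneg (fun _ => by positivity) h1.summable]

theorem posTrace_eq_tsum {ι : Type*} (b : HilbertBasis ι ℂ H) {T : H →L[ℂ] H} (hT : 0 ≤ T) :
    posTrace T = ∑' i, ENNReal.ofReal (RCLike.re ⟪b i, T (b i)⟫_ℂ) := by
  have hS : CFC.sqrt T * CFC.sqrt T = T := CFC.sqrt_mul_sqrt_self T hT
  set S := CFC.sqrt T with hSdef
  have hSsa : IsSelfAdjoint S := (CFC.sqrt_nonneg T).isSelfAdjoint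
  have hsymm : ∀ x y : H, ⟪S x, y⟫_ℂ = ⟪x, S y⟫_ℂ := fun x y =>
    ContinuousLinearMap.isSelfAdjoint_iff_isSymmetric.1 hSsa x y
  have hval : ∀ x : H, ENNReal.ofReal (RCLike.re ⟪x, T x⟫_ℂ) = ‖S x‖ₑ ^ 2 := by
    intro x
    rw [← hS, mul_apply_eq_comp, ← hsymm, inner_self_eq_norm_sq, ← ofReal_norm,
      ENNReal.ofReal_pow (norm_nonneg _)]
  obtain ⟨c, hc⟩ := (exists_hilbertBasis ℂ H).choose_spec
  unfold posTrace
  simp only [hval]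
  have h1 : ∀ i : (exists_hilbertBasis ℂ H).choose, ‖S (i : H)‖ₑ ^ 2 =
      ∑' j, ‖⟪b j, S (i : H)⟫_ℂ‖ₑ ^ 2 := fun i => (tsum_enorm_sq b _).symm
  have h2 : ∀ j, ‖S (b j)‖ₑ ^ 2 =
      ∑' i : (exists_hilbertBasis ℂ H).choose, ‖⟪b j, S (i : H)⟫_ℂ‖ₑ ^ 2 := by
    intro j
    rw [← tsum_enorm_sq c]
    refine tsum_congr fun i => ?_
    rw [hc, ← hsymm, ← inner_conj_symm, RCLike.enorm_conj]
  simp only [h1, h2]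
  exact ENNReal.tsum_comm

/-- The trace norm `‖T‖₁ = Tr |T|`, with value `∞` if `T` is not of trace class. -/
def traceNorm (T : H →L[ℂ] H) : ℝ≥0∞ := posTrace (CFC.abs T)

/-- The Schatten class `C_p`: bounded operators with `Tr (|T| ^ p) < ∞`. -/
def schattenClass (p : ℝ) : Set (H →L[ℂ] H) := {T | posTrace (CFC.abs T ^ p) < ∞}

variable (H) in
/-- The density operators: positive operators of trace one. -/
def densityOps : Set (H →L[ℂ] H) := {T | 0 ≤ T ∧ posTrace T = 1}

variable (H) in
/-- The underlying set of the information manifold: density operators in some `C_p`, `0 < p < 1`. -/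
def infoManifold : Set (H →L[ℂ] H) :=
  (⋃ p ∈ Set.Ioo (0 : ℝ) 1, schattenClass p) ∩ densityOps H

/-! ### Perturbed states and the Araki norm -/

/-- `exp (-A)` for a self-adjoint operator `A`. -/
def expNeg (A : H →ₗ.[ℂ] H) : H →ₗ.[ℂ] H := spectralFun A fun s => (Real.exp (-s) : ℂ)

/-- `σ = ρ_X`, i.e. `σ` is a density operator and `σ = exp (-H₀ - X - Ψ)` for some real
(normalizing) constant `Ψ`. The operator `H₀ + X + Ψ` has the domain of `H₀`. -/
def IsPerturbedState (H₀ : H →ₗ.[ℂ] H) (X σ : H →L[ℂ] H) : Prop :=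
  σ ∈ densityOps H ∧
    ∃ Ψ : ℝ, ofBounded σ = expNeg (((X + (Ψ : ℂ) • 1 : H →L[ℂ] H) : H →ₗ[ℂ] H) +ᵥ H₀)

/-- The power `ρ ^ t`, `t` complex, of a density operator with trivial kernel; it is bounded for
`0 ≤ re t` and in general unbounded for `re t < 0`. -/
def cpowOp (ρ : H →L[ℂ] H) (t : ℂ) : H →ₗ.[ℂ] H :=
  spectralFun (ofBounded ρ) fun s => (s : ℂ) ^ t

/-- The norm in `[0, ∞]` of `ρ ^ t X ρ ^ (-t)`, as the bound of the sesquilinear form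
`(u, v) ↦ ⟪u, ρ ^ t X ρ ^ (-t) v⟫ = ⟪ρ ^ (conj t) u, X ρ ^ (-t) v⟫`. -/
def conjNorm (ρ X : H →L[ℂ] H) (t : ℂ) : ℝ≥0∞ :=
  ⨆ (u : (cpowOp ρ (conj t)).domain) (v : (cpowOp ρ (-t)).domain)
    (_ : ‖(u : H)‖ ≤ 1) (_ : ‖(v : H)‖ ≤ 1),
    ‖⟪cpowOp ρ (conj t) u, X (cpowOp ρ (-t) v)⟫_ℂ‖ₑ

/-- The Araki norm `‖X‖_A`, the supremum of `‖ρ ^ t X ρ ^ (-t)‖` over complex `t` with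
`|t| < 1 / 2`, with value `∞` if the supremum is not finite. -/
def arakiNorm (ρ X : H →L[ℂ] H) : ℝ≥0∞ := ⨆ (t : ℂ) (_ : ‖t‖ < 1 / 2), conjNorm ρ X t

end QInfo

end

namespace QInfo

open Filter Topology

universe u

set_option linter.unusedSectionVars false

variable {H : Type u} [NormedAddCommGroup H] [InnerProductSpace ℂ H] [CompleteSpace H]

/-! ### Bounded operators that are diagonal in an orthonormal basis -/

/-! Put `A = H₀ + Ψ₀`, so that `ρ = exp (-A)`. Then `A` has an orthonormal eigenbasis `b` with
eigenvalues `a i → ∞`, and `R = (A + s)⁻¹` is compact for large `s`. Hence so is `(A + X + s)⁻¹ = R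
(1 + X R)⁻¹`, and `A + X` has an eigenbasis `c` with eigenvalues `d j` (`exists_diagOp_eq_vadd`).
The estimates need only the matrix relation `(d j - a i) ⟪b i, c j⟫ = ⟪b i, X (c j)⟫`
(`eigenvalue_sub_mul_inner`).

The Peierls bound `Tr exp (-t (A + X)) ≤ exp (t ‖X‖) Tr exp (-t A)` (`tsum_exp_neg_le`) at `t = 1`
allows `exp (-(A + X))` to be normalized in exactly one way; at `t = p` it puts the result in the
same Schatten class as `ρ`.

For the trace distance (`traceNorm_sub_le`), let `N = ‖ρ - σ‖₁` and let `J = Tr (ρ - σ)(log ρ - log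
σ)` be the symmetrized relative entropy. Since `log ρ - log σ` is `X` plus a constant and `Tr (ρ -
σ) = 0`, duality gives `J ≤ N ‖X‖`. In the other direction `N ^ 2 ≤ J`, a Pinsker inequality: with
`U = sign (ρ - σ)`, both `N = Tr (ρ - σ) U` and `J` are sums over pairs `(i, j)`, compared term by
term through "logarithmic mean ≤ arithmetic mean" (`two_mul_exp_sub_sq_le`,
`sub_mul_le_of_two_mul_sub_sq_le`). Together, `N ≤ ‖X‖`.

The bound by the Araki norm is its term at `t = 0`. -/

theorem inner_diag_apply {ι : Type*} (b : HilbertBasis ι ℂ H) {a : ι → ℂ} {T : H →L[ℂ] H}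
    (hT : ∀ i, T (b i) = a i • b i) (x : H) (i : ι) : ⟪b i, T x⟫_ℂ = a i * ⟪b i, x⟫_ℂ := by
  classical
  have h1 : HasSum (fun j => ⟪b i, T (b.repr x j • b j)⟫_ℂ) ⟪b i, T x⟫_ℂ :=
    ((b.hasSum_repr x).mapL T).mapL (innerSL ℂ (b i))
  have h2 : ∀ j, j ≠ i → ⟪b i, T (b.repr x j • b j)⟫_ℂ = 0 := by
    intro j hj
    rw [map_smul, hT, inner_smul_right, inner_smul_right, b.orthonormal.2 hj.symm]
    simp
  have h3 := h1.unique (hasSum_single i h2)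
  rw [h3, map_smul, hT, inner_smul_right, inner_smul_right, inner_self_eq_norm_sq_to_K,
    b.orthonormal.1 i, b.repr_apply_apply]
  simp [mul_comm]

theorem ofBounded_eq_diagOp_iff {ι : Type*} (b : HilbertBasis ι ℂ H) (a : ι → ℂ)
    (T : H →L[ℂ] H) : ofBounded T = diagOp b a ↔ ∀ i, T (b i) = a i • b i := by
  constructor
  · intro h i
    rw [← diagOp_basis b a i]
    have h1 : b i ∈ (ofBounded T).domain := Submodule.mem_top
    have h2 := (LinearPMap.ext_iff.1 h).2
    exact h2 (x := b i) (hf := h1) (hg := basis_mem_diagOp_domain b a i)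
  · intro h
    have key : ∀ x, (fun i => a i * b.repr x i) = (b.repr (T x) : ι → ℂ) := by
      intro x
      funext i
      rw [b.repr_apply_apply, b.repr_apply_apply, inner_diag_apply b h]
    have hmem : ∀ x, x ∈ (diagOp b a).domain := by
      intro x
      rw [mem_diagOp_domain, key]
      exact lp.memℓp _
    refine LinearPMap.ext (Submodule.ext fun x => ⟨fun _ => hmem x, fun _ => trivial⟩) ?_
    intro x hx hx'
    apply b.repr.injective
    ext i
    rw [repr_diagOp]
    exact (congrFun (key x) i).symm

/-- There is a bounded operator that is diagonal in `b` with a given bounded family `a` of eigenvalues. -/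
theorem exists_diag {ι : Type*} (b : HilbertBasis ι ℂ H) (a : ι → ℂ) {C : ℝ} (hC : 0 ≤ C)
    (h : ∀ i, ‖a i‖ ≤ C) : ∃ T : H →L[ℂ] H, (∀ i, T (b i) = a i • b i) ∧ ‖T‖ ≤ C := by
  have hle : ∀ x i, ‖a i * b.repr x i‖ ≤ ‖(C : ℂ) • b.repr x i‖ := by
    intro x i
    rw [norm_mul, norm_smul, Complex.norm_real, Real.norm_of_nonneg hC]
    exact mul_le_mul_of_nonneg_right (h i) (norm_nonneg _)
  have hmem : ∀ x, x ∈ (diagOp b a).domain := by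
    intro x
    rw [mem_diagOp_domain]
    exact (lp.memℓp ((C : ℂ) • b.repr x)).mono' (fun i => hle x i)
  let T₀ : H →ₗ[ℂ] H :=
    { toFun := fun x => diagOp b a ⟨x, hmem x⟩
      map_add' := fun x y => (diagOp b a).map_add ⟨x, hmem x⟩ ⟨y, hmem y⟩
      map_smul' := fun c x => (diagOp b a).map_smul c ⟨x, hmem x⟩ }
  have hb : ∀ x, ‖T₀ x‖ ≤ C * ‖x‖ := by
    intro x
    rw [← b.repr.norm_map, ← b.repr.norm_map x]
    have : ‖b.repr (T₀ x)‖ ≤ ‖(C : ℂ) • b.repr x‖ := by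
      refine lp.norm_mono (by norm_num) fun i => ?_
      have := repr_diagOp b a ⟨x, hmem x⟩ i
      change ‖b.repr (diagOp b a ⟨x, hmem x⟩) i‖ ≤ _
      rw [this]
      exact hle x i
    rwa [norm_smul, Complex.norm_real, Real.norm_of_nonneg hC] at this
  exact ⟨T₀.mkContinuous C hb, fun i => diagOp_basis b a i, T₀.mkContinuous_norm_le hC hb⟩

theorem diag_ext {ι : Type*} (b : HilbertBasis ι ℂ H) {a : ι → ℂ} {S T : H →L[ℂ] H}
    (hS : ∀ i, S (b i) = a i • b i) (hT : ∀ i, T (b i) = a i • b i) : S = T := by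
  ext x
  apply b.repr.injective
  ext i
  rw [b.repr_apply_apply, b.repr_apply_apply, inner_diag_apply b hS, inner_diag_apply b hT]

theorem diag_isSelfAdjoint {ι : Type*} (b : HilbertBasis ι ℂ H) {a : ι → ℝ} {T : H →L[ℂ] H}
    (hT : ∀ i, T (b i) = (a i : ℂ) • b i) : IsSelfAdjoint T := by
  rw [ContinuousLinearMap.isSelfAdjoint_iff_isSymmetric]
  intro x y
  change ⟪T x, y⟫_ℂ = ⟪x, T y⟫_ℂ
  rw [← b.tsum_inner_mul_inner, ← b.tsum_inner_mul_inner]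
  refine tsum_congr fun i => ?_
  rw [← inner_conj_symm (T x), inner_diag_apply b hT, inner_diag_apply b hT, map_mul,
    inner_conj_symm, Complex.conj_ofReal]
  ring

theorem diag_nonneg {ι : Type*} (b : HilbertBasis ι ℂ H) {a : ι → ℝ} {T : H →L[ℂ] H}
    (hT : ∀ i, T (b i) = (a i : ℂ) • b i) (ha : ∀ i, 0 ≤ a i) : 0 ≤ T := by
  rw [ContinuousLinearMap.nonneg_iff_isPositive, ContinuousLinearMap.isPositive_iff_complex]
  intro x
  have hsum := b.hasSum_inner_mul_inner (T x) x
  have hval : ∀ i, ⟪T x, b i⟫_ℂ * ⟪b i, x⟫_ℂ = ((a i * ‖⟪b i, x⟫_ℂ‖ ^ 2 : ℝ) : ℂ) := by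
    intro i
    rw [← inner_conj_symm (T x), inner_diag_apply b hT, map_mul, Complex.conj_ofReal, mul_assoc,
      ← Complex.normSq_eq_conj_mul_self, Complex.normSq_eq_norm_sq]
    push_cast
    ring
  simp only [hval] at hsum
  have hre := Complex.hasSum_re hsum
  have him := Complex.hasSum_im hsum
  simp only [Complex.ofReal_re, Complex.ofReal_im] at hre him
  have h0 := him.unique hasSum_zero
  refine ⟨Complex.ext (by simp) (by simpa using h0.symm), ?_⟩
  exact hre.nonneg fun i => mul_nonneg (ha i) (by positivity)

theorem posTrace_diag {ι : Type*} (b : HilbertBasis ι ℂ H) {a : ι → ℝ} {T : H →L[ℂ] H}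
    (hT : ∀ i, T (b i) = (a i : ℂ) • b i) (ha : ∀ i, 0 ≤ a i) :
    posTrace T = ∑' i, ENNReal.ofReal (a i) := by
  rw [posTrace_eq_tsum b (diag_nonneg b hT ha)]
  refine tsum_congr fun i => ?_
  rw [hT, inner_smul_right, inner_self_eq_norm_sq_to_K, b.orthonormal.1 i]
  simp

/-! ### The continuous functional calculus on eigenvectors -/

theorem mem_spectrum_of_apply_eq {T : H →L[ℂ] H} {v : H} (hv : v ≠ 0) {q : ℝ}
    (h : T v = (q : ℂ) • v) : q ∈ spectrum ℝ T := by
  rw [spectrum.mem_iff]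
  rintro ⟨u, hu⟩
  have h1 : (u : H →L[ℂ] H) v = 0 := by
    rw [hu, sub_apply, h, Algebra.algebraMap_eq_smul_one]
    simp
  apply hv
  have h2 : ((u⁻¹ : (H →L[ℂ] H)ˣ) * u : H →L[ℂ] H) v = 0 := by
    rw [mul_apply_eq_comp, h1, map_zero]
  simpa using h2

/-- By Stone–Weierstrass: the functions satisfying the identity form a closed subalgebra containing
the constants and the coordinate. This makes `|T|` and `T ^ p` explicit for diagonal `T`. -/
theorem cfc_apply_eigenvector {T : H →L[ℂ] H} (hT : IsSelfAdjoint T) {v : H} {q : ℝ}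
    (h : T v = (q : ℂ) • v) (f : ℝ → ℝ) (hf : ContinuousOn f (spectrum ℝ T)) :
    cfc f T v = (f q : ℂ) • v := by
  by_cases hv : v = 0
  · simp [hv]
  have hq := mem_spectrum_of_apply_eq hv h
  rw [cfc_apply f T hT hf]
  have key : ∀ g : C(spectrum ℝ T, ℝ), cfcHom hT g v = (g ⟨q, hq⟩ : ℂ) • v := by
    intro g
    induction g using ContinuousMap.induction_on_of_compact with
    | const r =>
      have : cfcHom hT (ContinuousMap.const (spectrum ℝ T) r) = algebraMap ℝ (H →L[ℂ] H) r :=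
        AlgHomClass.commutes (cfcHom hT) r
      rw [this, Algebra.algebraMap_eq_smul_one]
      simp
    | id => rw [cfcHom_id hT, h]; rfl
    | star_id => rw [map_star, cfcHom_id hT, hT.star_eq, h]; rfl
    | add f g hf hg => rw [map_add, add_apply, hf, hg, ← add_smul]; simp
    | mul f g hf hg =>
      rw [map_mul, mul_apply_eq_comp, hg, map_smul, hf, smul_smul]
      simp [mul_comm]
    | frequently f hf =>
      have hc : IsClosed {g : C(spectrum ℝ T, ℝ) | cfcHom hT g v = (g ⟨q, hq⟩ : ℂ) • v} := by
        refine isClosed_eq ?_ ?_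
        · exact (ContinuousLinearMap.apply ℂ H v).continuous.comp (cfcHom_continuous hT)
        · have : Continuous fun g : C(spectrum ℝ T, ℝ) => g ⟨q, hq⟩ :=
            continuous_eval_const _
          fun_prop
      exact hc.mem_of_frequently_of_tendsto hf tendsto_id
  exact key _

theorem traceNorm_diag {ι : Type*} (b : HilbertBasis ι ℂ H) {a : ι → ℝ} {T : H →L[ℂ] H}
    (hT : ∀ i, T (b i) = (a i : ℂ) • b i) :
    traceNorm T = ∑' i, ENNReal.ofReal |a i| := by
  have hsa := diag_isSelfAdjoint b hT
  refine posTrace_diag b (fun i => ?_) fun i => abs_nonneg _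
  rw [CFC.abs_eq_cfc_norm T hsa, cfc_apply_eigenvector hsa (hT i) _ (by fun_prop),
    Real.norm_eq_abs]

theorem mem_schattenClass_diag_iff {ι : Type*} (b : HilbertBasis ι ℂ H) {a : ι → ℝ}
    {T : H →L[ℂ] H} (hT : ∀ i, T (b i) = (a i : ℂ) • b i) (ha : ∀ i, 0 ≤ a i) {p : ℝ}
    (hp : 0 < p) : T ∈ schattenClass p ↔ ∑' i, ENNReal.ofReal (a i ^ p) < ∞ := by
  have hnn := diag_nonneg b hT ha
  have hsa := diag_isSelfAdjoint b hT
  have : posTrace (CFC.abs T ^ p) = ∑' i, ENNReal.ofReal (a i ^ p) := by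
    refine posTrace_diag b (fun i => ?_) fun i => Real.rpow_nonneg (ha i) p
    rw [CFC.abs_of_nonneg T hnn, CFC.rpow_eq_cfc_real hnn, cfc_apply_eigenvector hsa (hT i)]
    exact (Real.continuous_rpow_const hp.le).continuousOn
  rw [← this]
  rfl

/-! ### Compact operators -/

/-- The finite-rank truncations `F s` converge in norm, because the remainder is diagonal and its
norm is controlled by the discarded eigenvalues. -/
theorem diag_isCompactOperator {ι : Type*} (b : HilbertBasis ι ℂ H) {a : ι → ℂ} {T : H →L[ℂ] H}
    (hT : ∀ i, T (b i) = a i • b i) (ha : Tendsto a cofinite (𝓝 0)) : IsCompactOperator T := by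
  classical
  let F : Finset ι → H →L[ℂ] H := fun s =>
    ∑ i ∈ s, (a i) • ((innerSL ℂ (b i)).smulRight (b i))
  have hFb : ∀ s j, F s (b j) = (if j ∈ s then a j else 0) • b j := by
    intro s j
    simp only [F, sum_apply, smul_apply,
      ContinuousLinearMap.smulRight_apply, innerSL_apply_apply,
      orthonormal_iff_ite.1 b.orthonormal]
    simp
  have hlim : Tendsto F atTop (𝓝 T) := by
    rw [Metric.tendsto_atTop]
    intro ε hε
    have hfin : {i | ¬ ‖a i‖ < ε / 2}.Finite := by
      have := (tendsto_zero_iff_norm_tendsto_zero.1 ha).eventually (gt_mem_nhds (half_pos hε))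
      exact this
    refine ⟨hfin.toFinset, fun s hs => ?_⟩
    obtain ⟨S, hS, hSn⟩ := exists_diag b (fun i => if i ∈ s then 0 else a i) (half_pos hε).le
      (by
        intro i
        split_ifs with his
        · simpa using (half_pos hε).le
        · by_contra hcon
          apply his
          apply hs
          rw [Set.Finite.mem_toFinset]
          exact fun h => hcon h.le)
    have hTS : T - F s = S := by
      refine diag_ext b (fun i => ?_) hS
      rw [sub_apply, hT, hFb, ← sub_smul]
      congr 1
      split_ifs <;> simp
    rw [dist_comm, dist_eq_norm, hTS]
    linarith
  refine isCompactOperator_of_tendsto hlim (Eventually.of_forall fun s => ?_)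
  have : F s ∈ compactOperator (RingHom.id ℂ) H H := by
    refine Submodule.sum_mem _ fun i _ => Submodule.smul_mem _ _ ?_
    have h1 : IsCompactOperator (innerSL ℂ (b i) : H → ℂ) :=
      isCompactOperator_of_locallyCompactSpace_dom (innerSL ℂ (b i))
    exact h1.clm_comp ((1 : ℂ →L[ℂ] ℂ).smulRight (b i))
  exact this

/-- Hilbert bases of the eigenspaces, kernel included, are glued together; the spectral theorem for
compact operators says that nothing is orthogonal to all eigenspaces. -/
theorem exists_eigenbasis {K : H →L[ℂ] H} (hK : IsCompactOperator K) (hsa : IsSelfAdjoint K) :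
    ∃ (ι : Type u) (b : HilbertBasis ι ℂ H) (a : ι → ℝ), ∀ i, K (b i) = (a i : ℂ) • b i := by
  have hsymm := ContinuousLinearMap.isSelfAdjoint_iff_isSymmetric.1 hsa
  have hbot := ContinuousLinearMap.orthogonalComplement_iSup_eigenspaces_eq_bot hK hsymm
  let V : ℂ → Submodule ℂ H := fun μ => Module.End.eigenspace (K : H →ₗ[ℂ] H) μ
  have hmem : ∀ μ x, x ∈ V μ ↔ K x = μ • x := fun μ x => Module.End.mem_eigenspace_iff
  have hcomplete : ∀ μ, CompleteSpace (V μ) := by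
    intro μ
    have hcl : IsClosed (V μ : Set H) := by
      have : (V μ : Set H) = {x | K x = μ • x} := Set.ext fun x => hmem μ x
      rw [this]
      exact isClosed_eq K.continuous (continuous_const_smul μ)
    exact hcl.completeSpace_coe
  choose w c hc using fun μ => exists_hilbertBasis ℂ (V μ)
  have hon : Orthonormal ℂ fun s : Σ μ, w μ => ((c s.1 s.2 : V s.1) : H) :=
    hsymm.orthogonalFamily_eigenspaces.orthonormal_sigma_orthonormal fun μ => (c μ).orthonormal
  have horth : (Submodule.span ℂ
      (Set.range fun s : Σ μ, w μ => ((c s.1 s.2 : V s.1) : H)))ᗮ = ⊥ := by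
    rw [eq_bot_iff, ← hbot]
    intro x hx
    rw [← Submodule.iInf_orthogonal, Submodule.mem_iInf]
    intro μ
    rw [Submodule.mem_orthogonal]
    intro u hu
    have h0 : (innerSL ℂ x).comp (V μ).subtypeL = 0 := by
      have hd := (c μ).dense_span
      refine ContinuousLinearMap.ext_on (Submodule.dense_iff_topologicalClosure_eq_top.2 hd) ?_
      rintro _ ⟨i, rfl⟩
      have := (Submodule.mem_orthogonal' _ _).1 hx (c μ i)
        (Submodule.subset_span ⟨⟨μ, i⟩, rfl⟩)
      simpa using this
    have := congrArg (fun f => f ⟨u, hu⟩) h0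
    exact inner_eq_zero_symm.1 (by simpa using this)
  refine ⟨_, HilbertBasis.mkOfOrthogonalEqBot hon horth, fun s => s.1.re, fun s => ?_⟩
  rw [HilbertBasis.coe_mkOfOrthogonalEqBot]
  have h1 := (hmem _ _).1 (c s.1 s.2).2
  have h2 : ((c s.1 s.2 : V s.1) : H) ≠ 0 := hon.ne_zero s
  have h3 := hsymm.conj_eigenvalue_eq_self
    (Module.End.hasEigenvalue_of_hasEigenvector ⟨(c s.1 s.2).2, h2⟩)
  rw [h1, Complex.conj_eq_iff_re.1 h3]

/-! ### Bounded perturbations of diagonal operators -/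

/-- Here the diagonal operator is `T⁻¹ - s`; the bounded shift `s` does not affect the domain, which
is therefore the range of `T`. Unbounded operators are handled below through their bounded
resolvents. -/
theorem mem_diagOp_inv_sub_domain_iff {ι : Type*} (b : HilbertBasis ι ℂ H) {r : ι → ℂ}
    (hr : ∀ i, r i ≠ 0) (s : ℂ) {T : H →L[ℂ] H} (hT : ∀ i, T (b i) = r i • b i) (x : H) :
    x ∈ (diagOp b fun i => (r i)⁻¹ - s).domain ↔ ∃ y, T y = x := by
  rw [mem_diagOp_domain]
  constructor
  · intro hx
    have h1 : Memℓp (fun i => ((r i)⁻¹ - s) * b.repr x i + s * b.repr x i) 2 :=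
      hx.add (Memℓp.const_smul (lp.memℓp (b.repr x)) s)
    refine ⟨b.repr.symm ⟨_, h1⟩, ?_⟩
    apply b.repr.injective
    ext i
    rw [b.repr_apply_apply, inner_diag_apply b hT, ← b.repr_apply_apply,
      LinearIsometryEquiv.apply_symm_apply]
    change r i * (((r i)⁻¹ - s) * b.repr x i + s * b.repr x i) = b.repr x i
    have := hr i
    field_simp
    ring
  · rintro ⟨y, rfl⟩
    have h1 := lp.memℓp (b.repr (y - s • T y))
    refine Eq.mp (congrArg (Memℓp · 2) (funext fun i => ?_)) h1
    rw [b.repr_apply_apply, b.repr_apply_apply, inner_sub_right, inner_smul_right,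
      inner_diag_apply b hT]
    have := hr i
    field_simp

theorem diagOp_inv_sub_apply {ι : Type*} (b : HilbertBasis ι ℂ H) {r : ι → ℂ}
    (hr : ∀ i, r i ≠ 0) (s : ℂ) {T : H →L[ℂ] H} (hT : ∀ i, T (b i) = r i • b i) (y : H)
    (h : T y ∈ (diagOp b fun i => (r i)⁻¹ - s).domain) :
    diagOp b (fun i => (r i)⁻¹ - s) ⟨T y, h⟩ = y - s • T y := by
  apply b.repr.injective
  ext i
  rw [repr_diagOp, b.repr_apply_apply, b.repr_apply_apply, inner_sub_right, inner_smul_right,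
    inner_diag_apply b hT]
  have := hr i
  field_simp

/-- A bounded self-adjoint perturbation of a diagonal operator whose eigenvalues tend to infinity
has an orthonormal eigenbasis. -/
theorem exists_diagOp_eq_vadd {ι : Type*} (b : HilbertBasis ι ℂ H) {a : ι → ℝ}
    (ha : Tendsto a cofinite atTop) {X : H →L[ℂ] H} (hX : IsSelfAdjoint X) :
    ∃ (κ : Type u) (c : HilbertBasis κ ℂ H) (d : κ → ℝ),
      ((X : H →ₗ[ℂ] H) +ᵥ diagOp b fun i => (a i : ℂ)) = diagOp c fun j => (d j : ℂ) := by
  obtain ⟨m, hm⟩ : ∃ m, ∀ i, m ≤ a i := by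
    have hfin : {i | ¬ 0 ≤ a i}.Finite := ha.eventually_ge_atTop 0
    obtain ⟨m, hm⟩ := (hfin.image a).bddBelow
    refine ⟨min m 0, fun i => ?_⟩
    by_cases hi : 0 ≤ a i
    · exact (min_le_right _ _).trans hi
    · exact (min_le_left _ _).trans (hm ⟨i, hi, rfl⟩)
  -- With this shift the resolvent `R = (A + s)⁻¹` has norm at most `(‖X‖ + 1)⁻¹`, so `‖X R‖ < 1`
  -- and `1 + X R` is invertible.
  set s : ℝ := ‖X‖ + 1 - m with hs
  have hXpos : 0 < ‖X‖ + 1 := by positivity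
  have hpos : ∀ i, ‖X‖ + 1 ≤ a i + s := fun i => by have := hm i; rw [hs]; linarith
  have hpos' : ∀ i, 0 < a i + s := fun i => hXpos.trans_le (hpos i)
  obtain ⟨R, hR, hRn⟩ := exists_diag b (fun i => (((a i + s)⁻¹ : ℝ) : ℂ))
    (inv_pos.2 hXpos).le (by
      intro i
      rw [Complex.norm_real, Real.norm_of_nonneg (inv_pos.2 (hpos' i)).le]
      exact inv_anti₀ hXpos (hpos i))
  have hr0 : ∀ i, (((a i + s)⁻¹ : ℝ) : ℂ) ≠ 0 := fun i =>
    Complex.ofReal_ne_zero.2 (inv_pos.2 (hpos' i)).ne'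
  have hRcompact : IsCompactOperator R := by
    refine diag_isCompactOperator b hR ?_
    have h1 : Tendsto (fun i => (a i + s)⁻¹) cofinite (𝓝 0) :=
      (tendsto_atTop_add_const_right _ s ha).inv_tendsto_atTop
    have h2 := (Complex.continuous_ofReal.tendsto 0).comp h1
    rwa [Complex.ofReal_zero] at h2
  have hRsa : star R = R := diag_isSelfAdjoint b hR
  obtain ⟨W, hW⟩ : IsUnit (1 + X * R) := by
    have h1 : ‖-(X * R)‖ < 1 := by
      rw [norm_neg]
      calc ‖X * R‖ ≤ ‖X‖ * (‖X‖ + 1)⁻¹ := (norm_mul_le _ _).trans (by gcongr)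
        _ < 1 := by rw [← div_eq_mul_inv, div_lt_one hXpos]; linarith
    simpa [sub_neg_eq_add] using isUnit_one_sub_of_norm_lt_one h1
  -- Both sides are `R + R X R`; this intertwining makes `R W⁻¹` self-adjoint.
  have hWR : (star (W : H →L[ℂ] H)) * R = R * W := by
    rw [hW, star_add, star_one, star_mul, hRsa, hX.star_eq]
    noncomm_ring
  set V : H →L[ℂ] H := ((W⁻¹ : (H →L[ℂ] H)ˣ) : H →L[ℂ] H) with hV
  have hWV : (W : H →L[ℂ] H) * V = 1 := W.mul_inv
  have hVW : V * (W : H →L[ℂ] H) = 1 := W.inv_mul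
  -- `K` is `(A + X + s)⁻¹`, because `A + X + s = (1 + X R)(A + s)`.
  set K : H →L[ℂ] H := R * V with hKdef
  have hKsa : IsSelfAdjoint K := by
    have h1 : star V * star (W : H →L[ℂ] H) = 1 := by rw [← star_mul, hWV, star_one]
    change star (R * V) = R * V
    calc star (R * V) = star V * R * (W * V) := by rw [hWV, mul_one, star_mul, hRsa]
      _ = star V * (R * W) * V := by noncomm_ring
      _ = (star V * star (W : H →L[ℂ] H)) * R * V := by rw [← hWR]; noncomm_ring
      _ = R * V := by rw [h1, one_mul]
  have hKcompact : IsCompactOperator K := hRcompact.comp_clm V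
  obtain ⟨κ, c, k, hk⟩ := exists_eigenbasis hKcompact hKsa
  have hVapp : ∀ z, V z + X (R (V z)) = z := by
    intro z
    have h1 : (1 + X * R) (V z) = z := by
      rw [← hW]
      exact congrArg (fun f : H →L[ℂ] H => f z) hWV
    simpa using h1
  have hRinj : ∀ y, R y = 0 → y = 0 := by
    intro y hy
    apply b.repr.injective
    ext i
    have h1 := inner_diag_apply b hR y i
    rw [hy, inner_zero_right] at h1
    rw [b.repr_apply_apply, (mul_eq_zero.1 h1.symm).resolve_left (hr0 i)]
    simp
  have hk0 : ∀ j, (k j : ℂ) ≠ 0 := by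
    intro j hj
    have h1 : R (V (c j)) = 0 := by
      have := hk j
      rwa [hj, zero_smul] at this
    have h2 := hVapp (c j)
    rw [h1, hRinj _ h1] at h2
    simp only [map_zero, add_zero] at h2
    exact c.orthonormal.ne_zero j h2.symm
  refine ⟨κ, c, fun j => (k j)⁻¹ - s, ?_⟩
  have e1 : (fun i => (a i : ℂ)) = fun i => ((((a i + s)⁻¹ : ℝ) : ℂ))⁻¹ - (s : ℂ) := by
    funext i; push_cast; simp
  have e2 : (fun j => (((k j)⁻¹ - s : ℝ) : ℂ)) = fun j => (k j : ℂ)⁻¹ - (s : ℂ) := by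
    funext j; push_cast; rfl
  rw [e1, e2]
  -- `R` and `K` differ by the invertible factor `V`, so they have the same range: the perturbation
  -- keeps the domain.
  have hdom : ∀ x, (∃ y, R y = x) ↔ ∃ z, K z = x := by
    intro x
    constructor
    · rintro ⟨y, rfl⟩
      refine ⟨(W : H →L[ℂ] H) y, ?_⟩
      change R ((V * (W : H →L[ℂ] H)) y) = R y
      rw [hVW]; rfl
    · rintro ⟨z, rfl⟩
      exact ⟨V z, rfl⟩
  refine LinearPMap.ext (Submodule.ext fun x => ?_) ?_
  · rw [mem_diagOp_inv_sub_domain_iff c hk0 s hk, LinearPMap.vadd_domain,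
      mem_diagOp_inv_sub_domain_iff b hr0 s hR, hdom]
  · intro x hx hx'
    obtain ⟨z, rfl⟩ := (mem_diagOp_inv_sub_domain_iff c hk0 s hk x).1 hx'
    rw [diagOp_inv_sub_apply c hk0 s hk, LinearPMap.vadd_apply]
    have h1 := diagOp_inv_sub_apply b hr0 s hR (V z) hx
    change X (R (V z)) + diagOp b _ ⟨R (V z), hx⟩ = z - (s : ℂ) • R (V z)
    rw [h1, ← add_sub_assoc, add_comm (X _), hVapp]

/-- Pair the eigenvalue equation for `c j` with `b i`. This encodes "difference of the two operators
is `X`" without unbounded operators. -/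
theorem eigenvalue_sub_mul_inner {ι κ : Type*} {b : HilbertBasis ι ℂ H} {c : HilbertBasis κ ℂ H}
    {a : ι → ℂ} {d : κ → ℂ} {X : H →L[ℂ] H}
    (h : ((X : H →ₗ[ℂ] H) +ᵥ diagOp b a) = diagOp c d) (i : ι) (j : κ) :
    (d j - a i) * ⟪b i, c j⟫_ℂ = ⟪b i, X (c j)⟫_ℂ := by
  have hmem := basis_mem_diagOp_domain c d j
  have hmem' : c j ∈ (diagOp b a).domain := by rw [← h] at hmem; exact hmem
  have h1 : X (c j) + diagOp b a ⟨c j, hmem'⟩ = d j • c j := by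
    rw [← diagOp_basis c d j]
    have h2 := (LinearPMap.ext_iff.1 h).2
    exact h2 (x := c j) (hf := hmem') (hg := hmem)
  have h2 := congrArg (fun x => ⟪b i, x⟫_ℂ) h1
  simp only [inner_add_right, inner_smul_right] at h2
  rw [← b.repr_apply_apply (diagOp b a _), repr_diagOp, b.repr_apply_apply] at h2
  rw [sub_mul, ← h2]
  ring

/-! ### Summation lemmas and the Peierls inequality -/

theorem hasSum_congr {ι M : Type*} [AddCommMonoid M] [TopologicalSpace M] {f g : ι → M} {s : M}
    (h : ∀ i, f i = g i) : HasSum f s ↔ HasSum g s := by rw [funext h]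

theorem summable_of_tsum_ofReal_lt_top {ι : Type*} {f : ι → ℝ} (hf : ∀ i, 0 ≤ f i)
    (h : ∑' i, ENNReal.ofReal (f i) < ∞) : Summable f := by
  have := ENNReal.summable_toReal h.ne
  simpa only [ENNReal.toReal_ofReal (hf _)] using this

theorem hasSum_normSq_inner {ι : Type*} (b : HilbertBasis ι ℂ H) (x : H) :
    HasSum (fun i => ‖⟪b i, x⟫_ℂ‖ ^ 2) (‖x‖ ^ 2) := by
  have h2 := Complex.hasSum_re (b.hasSum_inner_mul_inner x x)
  have e1 : (⟪x, x⟫_ℂ).re = ‖x‖ ^ 2 := by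
    rw [inner_self_eq_norm_sq_to_K]; norm_cast
  have e2 : ∀ i, (⟪x, b i⟫_ℂ * ⟪b i, x⟫_ℂ).re = ‖⟪b i, x⟫_ℂ‖ ^ 2 := by
    intro i
    rw [← inner_conj_symm x (b i), ← Complex.normSq_eq_conj_mul_self, Complex.ofReal_re,
      Complex.normSq_eq_norm_sq]
  rw [e1] at h2
  simpa only [e2] using h2

/-- The Peierls inequality for a bounded perturbation of a diagonal operator. -/
theorem tsum_exp_neg_le {ι κ : Type*} {b : HilbertBasis ι ℂ H} {c : HilbertBasis κ ℂ H}
    {a : ι → ℝ} {d : κ → ℝ} {X : H →L[ℂ] H}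
    (h : ∀ i j, ((d j : ℂ) - a i) * ⟪b i, c j⟫_ℂ = ⟪b i, X (c j)⟫_ℂ) {t : ℝ} (ht : 0 ≤ t)
    (hsum : ∑' i, ENNReal.ofReal (Real.exp (-(t * a i))) < ∞) :
    ∑' j, ENNReal.ofReal (Real.exp (-(t * d j))) ≤
      ENNReal.ofReal (Real.exp (t * ‖X‖)) * ∑' i, ENNReal.ofReal (Real.exp (-(t * a i))) := by
  have key : ∀ j, ENNReal.ofReal (Real.exp (-(t * d j))) ≤
      ENNReal.ofReal (Real.exp (t * ‖X‖)) *
        ∑' i, ‖⟪b i, c j⟫_ℂ‖ₑ ^ 2 * ENNReal.ofReal (Real.exp (-(t * a i))) := by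
    intro j
    have hexp : Summable fun i => Real.exp (-(t * a i)) :=
      summable_of_tsum_ofReal_lt_top (fun i => (Real.exp_pos _).le) hsum
    have hw := hasSum_normSq_inner b (c j)
    rw [c.orthonormal.1 j, one_pow] at hw
    have hw1 : ∀ i, ‖⟪b i, c j⟫_ℂ‖ ^ 2 ≤ 1 := fun i =>
      le_hasSum hw i fun _ _ => by positivity
    set x : ℝ := (⟪c j, X (c j)⟫_ℂ).re with hx
    have hx_le : -‖X‖ ≤ x := by
      have h1 : ‖⟪c j, X (c j)⟫_ℂ‖ ≤ ‖X‖ := by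
        refine (norm_inner_le_norm _ _).trans ?_
        rw [c.orthonormal.1 j, one_mul]
        simpa [c.orthonormal.1 j] using X.le_opNorm (c j)
      exact (abs_le.1 ((Complex.abs_re_le_norm _).trans h1)).1
    -- `m` plays the role of `⟪c j, A (c j)⟫`: the mean of the `a i` under the probability weights
    -- `‖⟪b i, c j⟫‖ ^ 2`, as `hmean` shows.
    set m : ℝ := d j - x with hm
    have hmean : HasSum (fun i => ‖⟪b i, c j⟫_ℂ‖ ^ 2 * a i) m := by
      have h1 := Complex.hasSum_re (b.hasSum_inner_mul_inner (c j) (X (c j)))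
      have h2 := (hw.mul_right (d j)).sub h1
      rw [one_mul] at h2
      refine (hasSum_congr fun i => ?_).1 h2
      rw [← h i j, mul_left_comm, ← inner_conj_symm (c j), ← Complex.normSq_eq_conj_mul_self,
        Complex.normSq_eq_norm_sq, ← Complex.ofReal_sub, ← Complex.ofReal_mul, Complex.ofReal_re]
      ring
    have hbound : Summable fun i => ‖⟪b i, c j⟫_ℂ‖ ^ 2 * Real.exp (-(t * a i)) :=
      hexp.of_nonneg_of_le (fun i => by positivity) fun i =>
        mul_le_of_le_one_left (Real.exp_pos _).le (hw1 i)
    -- The tangent line of `exp (-t ·)` at `m`, averaged over the weights; comparing it termwise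
    -- with the exponential is Jensen's inequality.
    have htangent : HasSum (fun i => (‖⟪b i, c j⟫_ℂ‖ ^ 2 * (1 + t * m) -
        ‖⟪b i, c j⟫_ℂ‖ ^ 2 * a i * t) * Real.exp (-(t * m))) (Real.exp (-(t * m))) := by
      have h1 := ((hw.mul_right (1 + t * m)).sub (hmean.mul_right t)).mul_right
        (Real.exp (-(t * m)))
      have h2 : (1 * (1 + t * m) - m * t) * Real.exp (-(t * m)) = Real.exp (-(t * m)) := by ring
      rwa [h2] at h1
    have hjensen : Real.exp (-(t * m)) ≤
        ∑' i, ‖⟪b i, c j⟫_ℂ‖ ^ 2 * Real.exp (-(t * a i)) := by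
      refine hasSum_le (fun i => ?_) htangent hbound.hasSum
      have h1 : Real.exp (-(t * a i)) =
          Real.exp (t * m - t * a i) * Real.exp (-(t * m)) := by
        rw [← Real.exp_add]; ring_nf
      have h2 := Real.add_one_le_exp (t * m - t * a i)
      rw [h1, ← mul_assoc]
      refine mul_le_mul_of_nonneg_right ?_ (Real.exp_pos _).le
      calc _ = ‖⟪b i, c j⟫_ℂ‖ ^ 2 * (t * m - t * a i + 1) := by ring
        _ ≤ _ := by gcongr
    have hreal : Real.exp (-(t * d j)) ≤
        Real.exp (t * ‖X‖) * ∑' i, ‖⟪b i, c j⟫_ℂ‖ ^ 2 * Real.exp (-(t * a i)) := by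
      calc Real.exp (-(t * d j)) ≤ Real.exp (t * ‖X‖) * Real.exp (-(t * m)) := by
            rw [← Real.exp_add, Real.exp_le_exp, hm]
            nlinarith [mul_le_mul_of_nonneg_left hx_le ht]
        _ ≤ _ := by gcongr
    refine (ENNReal.ofReal_le_ofReal hreal).trans (le_of_eq ?_)
    rw [ENNReal.ofReal_mul (Real.exp_pos _).le,
      ENNReal.ofReal_tsum_of_nonneg (fun i => by positivity) hbound]
    congr 1
    refine tsum_congr fun i => ?_
    rw [ENNReal.ofReal_mul (by positivity), ENNReal.ofReal_pow (norm_nonneg _), ofReal_norm]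
  calc ∑' j, ENNReal.ofReal (Real.exp (-(t * d j)))
      ≤ ∑' j, ENNReal.ofReal (Real.exp (t * ‖X‖)) *
        ∑' i, ‖⟪b i, c j⟫_ℂ‖ₑ ^ 2 * ENNReal.ofReal (Real.exp (-(t * a i))) :=
        ENNReal.tsum_le_tsum key
    _ = _ := by
      -- The weights are doubly stochastic: after exchanging the sums, the sum over `j` is `‖b i‖ ^
      -- 2 = 1`.
      rw [ENNReal.tsum_mul_left, ENNReal.tsum_comm]
      congr 1
      refine tsum_congr fun i => ?_
      rw [ENNReal.tsum_mul_right]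
      have h1 : ∑' j, ‖⟪b i, c j⟫_ℂ‖ₑ ^ 2 = 1 := by
        have h2 := tsum_enorm_sq c (b i)
        have h3 : ‖b i‖ₑ = 1 := by rw [← ofReal_norm, b.orthonormal.1 i, ENNReal.ofReal_one]
        rw [h3, one_pow] at h2
        rw [← h2]
        refine tsum_congr fun j => ?_
        rw [← inner_conj_symm, RCLike.enorm_conj]
      rw [h1, one_mul]

/-! ### The trace distance of two states -/

/-- The logarithmic mean is at most the arithmetic mean. -/
theorem two_mul_exp_sub_sq_le (x y : ℝ) : 2 * (Real.exp x - Real.exp y) ^ 2 ≤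
    (Real.exp x - Real.exp y) * (x - y) * (Real.exp x + Real.exp y) := by
  wlog h : y ≤ x generalizing x y
  · linarith [this y x (le_of_not_ge h)]
  have hy := Real.exp_pos y
  set u := Real.exp (x - y) - 1 with hu
  have hu0 : 0 ≤ u := by
    rw [hu, sub_nonneg, Real.one_le_exp_iff]
    linarith
  have hx : Real.exp x = Real.exp y * (1 + u) := by
    rw [hu, add_sub_cancel, ← Real.exp_add, add_sub_cancel]
  -- With `u = exp (x - y) - 1`, the claim reduces to `2 u / (u + 2) ≤ log (1 + u)`.
  have h1 := Real.le_log_one_add_of_nonneg hu0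
  rw [hu, add_sub_cancel, Real.log_exp, ← hu, div_le_iff₀ (by linarith)] at h1
  have h2 : 0 ≤ Real.exp y * u * Real.exp y := by positivity
  rw [hx]
  nlinarith [mul_le_mul_of_nonneg_left h1 h2]

/-- A weighted arithmetic–geometric mean inequality: after `m` is eliminated through `h`, the gap is
the perfect square in `h2`. In the application `m` is a difference of logarithms, `x = ‖⟪b i, c
j⟫‖`, `y = ‖⟪b i, U (c j)⟫‖`, and the free weight `N` is the trace norm itself. -/
theorem sub_mul_le_of_two_mul_sub_sq_le {p q m x y r N : ℝ} (hp : 0 < p) (hq : 0 < q) (hN : 0 < N)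
    (h : 2 * (p - q) ^ 2 ≤ (p - q) * m * (p + q)) (hr : |r| ≤ x * y) :
    (p - q) * r ≤ N⁻¹ / 2 * ((p - q) * m * x ^ 2) + N / 4 * (p * y ^ 2 + q * y ^ 2) := by
  have hS : 0 < p + q := add_pos hp hq
  have h1 : 2 * |p - q| ^ 2 / (p + q) ≤ (p - q) * m := by rwa [sq_abs, div_le_iff₀ hS]
  have h2 : N⁻¹ / 2 * (2 * |p - q| ^ 2 / (p + q) * x ^ 2) + N / 4 * (p * y ^ 2 + q * y ^ 2) -
      |p - q| * (x * y) = (2 * |p - q| * x - N * (p + q) * y) ^ 2 / (4 * N * (p + q)) := by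
    generalize |p - q| = D
    field_simp
    ring
  have h3 : 0 ≤ (2 * |p - q| * x - N * (p + q) * y) ^ 2 / (4 * N * (p + q)) := by positivity
  calc (p - q) * r ≤ |p - q| * |r| := by rw [← abs_mul]; exact le_abs_self _
    _ ≤ |p - q| * (x * y) := by gcongr
    _ ≤ N⁻¹ / 2 * (2 * |p - q| ^ 2 / (p + q) * x ^ 2) + N / 4 * (p * y ^ 2 + q * y ^ 2) := by
      linarith
    _ ≤ _ := by gcongr

/-! ### Traces as double sums over two eigenbases -/

theorem exists_hasSum_prod_mul {ι κ : Type*} {p : ι → ℝ} (hp0 : ∀ i, 0 ≤ p i) (hp : HasSum p 1)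
    {g : ι → κ → ℝ} (hg : ∀ i j, 0 ≤ g i j) {G : ι → ℝ} (hG : ∀ i, HasSum (g i) (G i))
    {C : ℝ} (hGC : ∀ i, G i ≤ C) :
    ∃ s ≤ C, HasSum (fun s : ι × κ => p s.1 * g s.1 s.2) s := by
  have h1 : ∀ i, HasSum (fun j => p i * g i j) (p i * G i) := fun i => (hG i).mul_left _
  have h0 : ∀ i, 0 ≤ G i := fun i => (hG i).nonneg (hg i)
  have h3 : HasSum (fun i => p i * C) C := by simpa using hp.mul_right C
  have h4 : ∀ i, p i * G i ≤ p i * C := fun i => mul_le_mul_of_nonneg_left (hGC i) (hp0 i)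
  have h2 : Summable fun s : ι × κ => p s.1 * g s.1 s.2 := by
    rw [summable_prod_of_nonneg fun s => mul_nonneg (hp0 _) (hg _ _)]
    refine ⟨fun i => (h1 i).summable, ?_⟩
    simp only [fun i => (h1 i).tsum_eq]
    exact h3.summable.of_nonneg_of_le (fun i => mul_nonneg (hp0 i) (h0 i)) h4
  exact ⟨_, hasSum_le h4 (h2.hasSum.prod_fiberwise h1) h3, h2.hasSum⟩

/-- This is `Tr ρ U` for `ρ` with eigenvalues `p`, with Parseval in `c` inserted. Unconditional
summability over pairs lets the expansions for two states be subtracted term by term and their sums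
exchanged. -/
theorem hasSum_trace_prod {ι κ : Type*} (b : HilbertBasis ι ℂ H) (c : HilbertBasis κ ℂ H)
    {p : ι → ℝ} (hp0 : ∀ i, 0 ≤ p i) (hp : HasSum p 1) {U : H →L[ℂ] H} (hU : IsSelfAdjoint U) :
    HasSum (fun s : ι × κ => (p s.1 : ℂ) * (⟪c s.2, b s.1⟫_ℂ * ⟪b s.1, U (c s.2)⟫_ℂ))
      (∑' i, (p i : ℂ) * ⟪b i, U (b i)⟫_ℂ) := by
  have hsymm : ∀ x y, ⟪U x, y⟫_ℂ = ⟪x, U y⟫_ℂ :=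
    ContinuousLinearMap.isSelfAdjoint_iff_isSymmetric.1 hU
  have hfib : ∀ i, HasSum (fun j => (p i : ℂ) * (⟪c j, b i⟫_ℂ * ⟪b i, U (c j)⟫_ℂ))
      ((p i : ℂ) * ⟪b i, U (b i)⟫_ℂ) := by
    intro i
    have h1 := (c.hasSum_inner_mul_inner (U (b i)) (b i)).mul_left (p i : ℂ)
    simp only [hsymm] at h1
    refine (hasSum_congr fun j => ?_).1 h1
    ring
  have hsummable : Summable fun s : ι × κ =>
      (p s.1 : ℂ) * (⟪c s.2, b s.1⟫_ℂ * ⟪b s.1, U (c s.2)⟫_ℂ) := by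
    obtain ⟨s, -, hs⟩ := exists_hasSum_prod_mul hp0 hp
      (g := fun i j => ‖⟪c j, b i⟫_ℂ‖ ^ 2 + ‖⟪c j, U (b i)⟫_ℂ‖ ^ 2)
      (fun i j => by positivity)
      (fun i => (hasSum_normSq_inner c (b i)).add (hasSum_normSq_inner c (U (b i))))
      (C := 1 + ‖U‖ ^ 2) (by
        intro i
        have := U.le_opNorm (b i)
        rw [b.orthonormal.1 i, mul_one] at this
        rw [b.orthonormal.1 i, one_pow]
        gcongr)
    refine Summable.of_norm_bounded hs.summable fun s => ?_
    rw [norm_mul, Complex.norm_real, Real.norm_of_nonneg (hp0 _), norm_mul]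
    refine mul_le_mul_of_nonneg_left ?_ (hp0 _)
    have h1 : ‖⟪b s.1, U (c s.2)⟫_ℂ‖ = ‖⟪c s.2, U (b s.1)⟫_ℂ‖ := by
      rw [← hsymm, norm_inner_symm]
    rw [h1]
    nlinarith [sq_nonneg (‖⟪c s.2, b s.1⟫_ℂ‖ - ‖⟪c s.2, U (b s.1)⟫_ℂ‖),
      sq_nonneg ‖⟪c s.2, b s.1⟫_ℂ‖, sq_nonneg ‖⟪c s.2, U (b s.1)⟫_ℂ‖]
  have h1 := (hsummable.hasSum.prod_fiberwise hfib).tsum_eq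
  rw [h1]
  exact hsummable.hasSum

theorem hasSum_trace {ι κ : Type*} (b : HilbertBasis ι ℂ H) (c : HilbertBasis κ ℂ H)
    {p : ι → ℝ} (hp0 : ∀ i, 0 ≤ p i) (hp : HasSum p 1) {ρ : H →L[ℂ] H}
    (hρ : ∀ i, ρ (b i) = (p i : ℂ) • b i) {U : H →L[ℂ] H} (hU : IsSelfAdjoint U) :
    HasSum (fun k => ⟪ρ (c k), U (c k)⟫_ℂ) (∑' i, (p i : ℂ) * ⟪b i, U (b i)⟫_ℂ) := by
  have h1 := (Equiv.prodComm κ ι).hasSum_iff.2 (hasSum_trace_prod b c hp0 hp hU)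
  refine h1.prod_fiberwise fun k => ?_
  refine (hasSum_congr fun i => ?_).1 (b.hasSum_inner_mul_inner (ρ (c k)) (U (c k)))
  rw [← inner_conj_symm, inner_diag_apply b hρ, map_mul, Complex.conj_ofReal, inner_conj_symm]
  simp [mul_assoc]

/-- The common value is `Tr (ρ - σ) U`: the pair sum meets the matrix relation for `X`, the sum over
`f` meets the trace norm. -/
theorem hasSum_trace_sub {ι κ l : Type*} (b : HilbertBasis ι ℂ H) (c : HilbertBasis κ ℂ H)
    (f : HilbertBasis l ℂ H) {p : ι → ℝ} (hp0 : ∀ i, 0 ≤ p i) (hp : HasSum p 1)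
    {q : κ → ℝ} (hq0 : ∀ j, 0 ≤ q j) (hq : HasSum q 1) {ρ σ : H →L[ℂ] H}
    (hρ : ∀ i, ρ (b i) = (p i : ℂ) • b i) (hσ : ∀ j, σ (c j) = (q j : ℂ) • c j)
    {δ : l → ℝ} (hδ : ∀ k, (ρ - σ) (f k) = (δ k : ℂ) • f k)
    {U : H →L[ℂ] H} (hU : IsSelfAdjoint U) :
    ∃ s : ℝ, HasSum (fun s : ι × κ =>
        (p s.1 - q s.2) * (⟪c s.2, b s.1⟫_ℂ * ⟪b s.1, U (c s.2)⟫_ℂ).re) s ∧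
      HasSum (fun k => δ k * (⟪f k, U (f k)⟫_ℂ).re) s := by
  have hsymm : ∀ x y, ⟪U x, y⟫_ℂ = ⟪x, U y⟫_ℂ :=
    ContinuousLinearMap.isSelfAdjoint_iff_isSymmetric.1 hU
  refine ⟨((∑' i, (p i : ℂ) * ⟪b i, U (b i)⟫_ℂ) - ∑' j, (q j : ℂ) * ⟪c j, U (c j)⟫_ℂ).re, ?_, ?_⟩
  · have h1 := Complex.hasSum_re (hasSum_trace_prod b c hp0 hp hU)
    have h2 := Complex.hasSum_re ((Equiv.prodComm ι κ).hasSum_iff.2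
      (hasSum_trace_prod c b hq0 hq hU))
    rw [Complex.sub_re]
    refine (hasSum_congr fun s => ?_).1 (h1.sub h2)
    -- The terms of the two expansions are conjugate to each other, so real parts are taken to
    -- combine them.
    have h3 : ⟪b s.1, c s.2⟫_ℂ * ⟪c s.2, U (b s.1)⟫_ℂ =
        conj (⟪c s.2, b s.1⟫_ℂ * ⟪b s.1, U (c s.2)⟫_ℂ) := by
      rw [map_mul, inner_conj_symm, inner_conj_symm, hsymm]
    simp only [Function.comp_apply, Equiv.prodComm_apply, Prod.fst_swap, Prod.snd_swap, h3,
      Complex.re_ofReal_mul, Complex.conj_re]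
    ring
  · have h1 := Complex.hasSum_re
      ((hasSum_trace b f hp0 hp hρ hU).sub (hasSum_trace c f hq0 hq hσ hU))
    refine (hasSum_congr fun k => ?_).1 h1
    rw [← inner_sub_left, ← sub_apply, hδ, inner_smul_left, Complex.conj_ofReal,
      Complex.re_ofReal_mul]

theorem traceNorm_sub_le {ι κ : Type*} {b : HilbertBasis ι ℂ H} {c : HilbertBasis κ ℂ H}
    {a : ι → ℝ} {d : κ → ℝ} (hp : HasSum (fun i => Real.exp (-a i)) 1)
    (hq : HasSum (fun j => Real.exp (-d j)) 1) {ρ σ : H →L[ℂ] H}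
    (hρ : ∀ i, ρ (b i) = (Real.exp (-a i) : ℂ) • b i)
    (hσ : ∀ j, σ (c j) = (Real.exp (-d j) : ℂ) • c j)
    {X : H →L[ℂ] H} (hX : IsSelfAdjoint X) {t : ℝ}
    (h : ∀ i j, ((d j : ℂ) - a i) * ⟪b i, c j⟫_ℂ = ⟪b i, (X + (t : ℂ) • 1 : H →L[ℂ] H) (c j)⟫_ℂ) :
    traceNorm (ρ - σ) ≤ ‖X‖ₑ := by
  have hp0 : ∀ i, 0 ≤ Real.exp (-a i) := fun i => (Real.exp_pos _).le
  have hq0 : ∀ j, 0 ≤ Real.exp (-d j) := fun j => (Real.exp_pos _).le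
  have hcompact : IsCompactOperator (ρ - σ : H →L[ℂ] H) := by
    have h1 := (Complex.continuous_ofReal.tendsto 0).comp hp.summable.tendsto_cofinite_zero
    have h2 := (Complex.continuous_ofReal.tendsto 0).comp hq.summable.tendsto_cofinite_zero
    rw [Complex.ofReal_zero] at h1 h2
    exact (diag_isCompactOperator b hρ h1).sub (diag_isCompactOperator c hσ h2)
  obtain ⟨l, f, δ, hδ⟩ := exists_eigenbasis hcompact
    ((diag_isSelfAdjoint b hρ).sub (diag_isSelfAdjoint c hσ))
  have hTr := fun (U : H →L[ℂ] H) (hU : IsSelfAdjoint U) =>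
    hasSum_trace_sub b c f hp0 hp hq0 hq hρ hσ hδ hU
  -- `U = sign (ρ - σ)`, a contraction commuting with `ρ - σ`.
  obtain ⟨U, hUf, hUn⟩ := exists_diag f (fun k => ((SignType.sign (δ k) : ℝ) : ℂ)) zero_le_one (by
    intro k
    rcases lt_trichotomy (δ k) 0 with hk | hk | hk <;> simp [hk])
  have hU : IsSelfAdjoint U := diag_isSelfAdjoint f hUf
  have hUx : ∀ x, ‖x‖ = 1 → ‖U x‖ ^ 2 ≤ 1 := by
    intro x hx
    have h1 := U.le_of_opNorm_le hUn x
    rw [hx, one_mul] at h1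
    exact pow_le_one₀ (norm_nonneg _) h1
  have hsymm : ∀ x y, ⟪U x, y⟫_ℂ = ⟪x, U y⟫_ℂ :=
    ContinuousLinearMap.isSelfAdjoint_iff_isSymmetric.1 hU
  have hdiag : ∀ k, ⟪f k, f k⟫_ℂ = 1 := fun k => by
    rw [inner_self_eq_norm_sq_to_K, f.orthonormal.1 k]; simp
  -- the trace norm is the trace of `U * (ρ - σ)`
  obtain ⟨N, hN1, hN2⟩ := hTr U hU
  have hN : HasSum (fun k => |δ k|) N := by
    refine (hasSum_congr fun k => ?_).1 hN2
    rw [hUf, inner_smul_right, hdiag, mul_one, Complex.ofReal_re, mul_comm, sign_mul_self]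
  rw [traceNorm_diag f hδ, ← ENNReal.ofReal_tsum_of_nonneg (fun _ => abs_nonneg _) hN.summable,
    hN.tsum_eq, ← ofReal_norm]
  refine ENNReal.ofReal_le_ofReal ?_
  -- the symmetrized relative entropy
  obtain ⟨J, hJ1, hJ2⟩ := hTr (X + (t : ℂ) • 1) (hX.add (by
    rw [IsSelfAdjoint, star_smul, star_one]; simp))
  obtain ⟨Z, hZ1, hZ2⟩ := hTr 1 (IsSelfAdjoint.one _)
  -- Both states have trace one, so the constant `t` will not contribute to `J`.
  have hZ : Z = 0 := by
    have h1 := (hasSum_trace b f hp0 hp hρ (IsSelfAdjoint.one _)).sub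
      (hasSum_trace c f hq0 hq hσ (IsSelfAdjoint.one _))
    have hb : ∀ i, (Real.exp (-a i) : ℂ) * ⟪b i, (1 : H →L[ℂ] H) (b i)⟫_ℂ = Real.exp (-a i) :=
      fun i => by simp [inner_self_eq_norm_sq_to_K, b.orthonormal.1 i]
    have hc : ∀ j, (Real.exp (-d j) : ℂ) * ⟪c j, (1 : H →L[ℂ] H) (c j)⟫_ℂ = Real.exp (-d j) :=
      fun j => by simp [inner_self_eq_norm_sq_to_K, c.orthonormal.1 j]
    rw [tsum_congr hb, tsum_congr hc, ← Complex.ofReal_tsum, ← Complex.ofReal_tsum, hp.tsum_eq,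
      hq.tsum_eq, sub_self] at h1
    refine hZ2.unique ((hasSum_congr fun k => ?_).1 (Complex.hasSum_re h1))
    rw [← inner_sub_left, ← sub_apply, hδ, inner_smul_left, Complex.conj_ofReal,
      Complex.re_ofReal_mul]
  have hJle : J ≤ N * ‖X‖ := by
    have h1 := hJ2.sub (hZ2.mul_right t)
    rw [hZ, zero_mul, sub_zero] at h1
    refine hasSum_le (fun k => ?_) h1 (hN.mul_right ‖X‖)
    have h2 : ‖⟪f k, X (f k)⟫_ℂ‖ ≤ ‖X‖ := by
      refine (norm_inner_le_norm _ _).trans ?_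
      rw [f.orthonormal.1 k, one_mul]
      simpa [f.orthonormal.1 k] using X.le_opNorm (f k)
    have h3 : δ k * (⟪f k, (X + (t : ℂ) • 1 : H →L[ℂ] H) (f k)⟫_ℂ).re -
        δ k * (⟪f k, (1 : H →L[ℂ] H) (f k)⟫_ℂ).re * t = δ k * (⟪f k, X (f k)⟫_ℂ).re := by
      simp
      ring
    rw [h3]
    refine (le_abs_self _).trans ?_
    rw [abs_mul]
    exact mul_le_mul_of_nonneg_left ((Complex.abs_re_le_norm _).trans h2) (abs_nonneg _)
  -- Substituting the matrix relation `h` turns `J` into a sum of nonnegative terms.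
  have hJ : HasSum (fun s : ι × κ => (Real.exp (-a s.1) - Real.exp (-d s.2)) *
      (d s.2 - a s.1) * ‖⟪b s.1, c s.2⟫_ℂ‖ ^ 2) J := by
    refine (hasSum_congr fun s => ?_).1 hJ1
    rw [← h, mul_left_comm, ← inner_conj_symm (c s.2), ← Complex.normSq_eq_conj_mul_self,
      Complex.normSq_eq_norm_sq, ← Complex.ofReal_sub, ← Complex.ofReal_mul, Complex.ofReal_re]
    ring
  -- `s₁ = Tr ρ U²` and `s₂ = Tr σ U²`, each at most one.
  obtain ⟨s₁, hs₁, hS₁⟩ := exists_hasSum_prod_mul hp0 hp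
    (g := fun i j => ‖⟪c j, U (b i)⟫_ℂ‖ ^ 2) (fun _ _ => by positivity)
    (fun i => hasSum_normSq_inner c (U (b i))) (fun i => hUx _ (b.orthonormal.1 i))
  obtain ⟨s₂, hs₂, hS₂'⟩ := exists_hasSum_prod_mul hq0 hq
    (g := fun j i => ‖⟪b i, U (c j)⟫_ℂ‖ ^ 2) (fun _ _ => by positivity)
    (fun j => hasSum_normSq_inner b (U (c j))) (fun j => hUx _ (c.orthonormal.1 j))
  have hS₂ := (Equiv.prodComm ι κ).hasSum_iff.2 hS₂'
  rcases (hN.nonneg fun _ => abs_nonneg _).eq_or_lt with hN0 | hNpos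
  · rw [← hN0]; exact norm_nonneg _
  -- Combined with `J ≤ N ‖X‖` and `s₁ + s₂ ≤ 2`, this reads `N ≤ ‖X‖ / 2 + N / 2`.
  have hfinal : N ≤ N⁻¹ / 2 * J + N / 4 * (s₁ + s₂) := by
    refine hasSum_le (fun s => ?_) hN1 ((hJ.mul_left (N⁻¹ / 2)).add ((hS₁.add hS₂).mul_left (N / 4)))
    have h1 : ‖⟪c s.2, U (b s.1)⟫_ℂ‖ = ‖⟪b s.1, U (c s.2)⟫_ℂ‖ := by
      rw [← hsymm, norm_inner_symm]
    have h2 : ‖⟪c s.2, b s.1⟫_ℂ‖ = ‖⟪b s.1, c s.2⟫_ℂ‖ := norm_inner_symm _ _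
    simp only [Function.comp_apply, Equiv.prodComm_apply, Prod.fst_swap, Prod.snd_swap, h1]
    have h3 : |(⟪c s.2, b s.1⟫_ℂ * ⟪b s.1, U (c s.2)⟫_ℂ).re| ≤
        ‖⟪b s.1, c s.2⟫_ℂ‖ * ‖⟪b s.1, U (c s.2)⟫_ℂ‖ := by
      rw [← h2, ← norm_mul]; exact Complex.abs_re_le_norm _
    have h4 := two_mul_exp_sub_sq_le (-a s.1) (-d s.2)
    have h5 : -a s.1 - -d s.2 = d s.2 - a s.1 := by ring
    rw [h5] at h4
    exact sub_mul_le_of_two_mul_sub_sq_le (Real.exp_pos _) (Real.exp_pos _) hNpos h4 h3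
  have h1 : N⁻¹ / 2 * J ≤ ‖X‖ / 2 := by
    calc N⁻¹ / 2 * J ≤ N⁻¹ / 2 * (N * ‖X‖) := by gcongr
      _ = ‖X‖ / 2 := by field_simp
  have h2 : N / 4 * (s₁ + s₂) ≤ N / 4 * 2 := by gcongr; linarith
  linarith

/-! ### The Araki norm -/

theorem enorm_le_arakiNorm {ι : Type*} (b : HilbertBasis ι ℂ H) {p : ι → ℝ} {ρ : H →L[ℂ] H}
    (hρ : ∀ i, ρ (b i) = (p i : ℂ) • b i) (X : H →L[ℂ] H) : ‖X‖ₑ ≤ arakiNorm ρ X := by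
  -- The convention `0 ^ 0 = 1` makes the zeroth power the identity on any eigenvector, so the form
  -- at `t = 0` is `⟪u, X v⟫`.
  have hone : cpowOp ρ 0 = ofBounded (1 : H →L[ℂ] H) := by
    rw [cpowOp, (ofBounded_eq_diagOp_iff b _ ρ).2 hρ, spectralFun_diagOp]
    exact ((ofBounded_eq_diagOp_iff b _ 1).2 fun i => by simp).symm
  have hle : conjNorm ρ X 0 ≤ arakiNorm ρ X :=
    le_iSup₂_of_le (f := fun (t : ℂ) (_ : ‖t‖ < 1 / 2) => conjNorm ρ X t) 0 (by simp) le_rfl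
  refine le_trans ?_ hle
  have hinner : ∀ u v : H, ‖u‖ ≤ 1 → ‖v‖ ≤ 1 → ‖⟪u, X v⟫_ℂ‖ₑ ≤ conjNorm ρ X 0 := by
    intro u v hu hv
    unfold conjNorm
    rw [map_zero, neg_zero, hone]
    refine le_iSup_of_le (⟨u, trivial⟩ : (ofBounded (1 : H →L[ℂ] H)).domain) ?_
    refine le_iSup_of_le (⟨v, trivial⟩ : (ofBounded (1 : H →L[ℂ] H)).domain) ?_
    exact le_iSup₂_of_le hu hv le_rfl
  by_cases htop : conjNorm ρ X 0 = ∞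
  · rw [htop]; exact le_top
  lift conjNorm ρ X 0 to NNReal using htop with C
  have hinner' : ∀ u v : H, ‖u‖ ≤ 1 → ‖v‖ ≤ 1 → ‖⟪u, X v⟫_ℂ‖ ≤ C := by
    intro u v hu hv
    have h1 := hinner u v hu hv
    rw [enorm_le_coe] at h1
    exact h1
  rw [enorm_le_coe]
  refine X.opNorm_le_of_re_inner_le (𝕜 := ℂ) C.2 fun x y hx hy => ?_
  refine (Complex.re_le_norm _).trans ?_
  rw [norm_inner_symm]
  exact hinner' y x hy.le hx.le

/-! ### Perturbed states -/

theorem vadd_smul_one_diagOp {ι : Type*} (b : HilbertBasis ι ℂ H) (a : ι → ℂ) (s : ℂ) :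
    (((s • 1 : H →L[ℂ] H) : H →ₗ[ℂ] H) +ᵥ diagOp b a) = diagOp b fun i => a i + s := by
  refine LinearPMap.ext (Submodule.ext fun x => ?_) ?_
  · rw [LinearPMap.vadd_domain, mem_diagOp_domain, mem_diagOp_domain]
    have hs : Memℓp (s • (b.repr x : ι → ℂ)) 2 := (lp.memℓp (b.repr x)).const_smul s
    constructor
    · intro h
      refine Eq.mp (congrArg (Memℓp · 2) (funext fun i => ?_)) (h.add hs)
      simp [add_mul]
    · intro h
      refine Eq.mp (congrArg (Memℓp · 2) (funext fun i => ?_)) (h.sub hs)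
      simp [add_mul]
  · intro x hx hx'
    apply b.repr.injective
    ext i
    rw [repr_diagOp, LinearPMap.vadd_apply, map_add, lp.coeFn_add, Pi.add_apply]
    have h1 := repr_diagOp b a ⟨x, hx⟩ i
    have h2 : b.repr (((s • 1 : H →L[ℂ] H) : H →ₗ[ℂ] H) x) i = s * b.repr x i := by
      change b.repr (s • x) i = _
      rw [map_smul]
      rfl
    exact (congrArg₂ (· + ·) h2 h1).trans (by ring)

theorem vadd_add_smul_one (A : H →ₗ.[ℂ] H) (X : H →L[ℂ] H) (s r : ℂ) :
    (((X + (s + r) • 1 : H →L[ℂ] H) : H →ₗ[ℂ] H) +ᵥ A) =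
      ((s • 1 : H →L[ℂ] H) : H →ₗ[ℂ] H) +ᵥ
        ((X : H →ₗ[ℂ] H) +ᵥ (((r • 1 : H →L[ℂ] H) : H →ₗ[ℂ] H) +ᵥ A)) := by
  rw [vadd_vadd, vadd_vadd]
  congr 1
  ext x
  simp [add_smul]
  abel

theorem nontrivial_of_mem_densityOps {ρ : H →L[ℂ] H} (h : ρ ∈ densityOps H) : Nontrivial H := by
  by_contra hcon
  rw [not_nontrivial_iff_subsingleton] at hcon
  have h1 := h.2
  have h2 : posTrace ρ = 0 := by
    unfold posTrace
    refine ENNReal.tsum_eq_zero.2 fun i => ?_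
    rw [Subsingleton.elim (i : H) 0]
    simp
  rw [h2] at h1
  exact zero_ne_one h1

/-- Were `A` not diagonalizable, `expNeg A` would take the default value with domain `{0}`, which
cannot be everywhere defined on a nontrivial space. -/
theorem exists_diagOp_of_ofBounded_eq_expNeg [Nontrivial H] {σ : H →L[ℂ] H} {A : H →ₗ.[ℂ] H}
    (h : ofBounded σ = expNeg A) :
    ∃ (w : Set H) (b : HilbertBasis w ℂ H) (a : w → ℝ), A = diagOp b fun i => (a i : ℂ) := by
  by_contra hcon
  have h1 : expNeg A = ⊥ := dif_neg hcon
  rw [h1] at h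
  have h2 : (⊤ : Submodule ℂ H) = ⊥ := congrArg LinearPMap.domain h
  exact top_ne_bot h2

theorem ofBounded_eq_expNeg_diagOp_iff {ι : Type*} (b : HilbertBasis ι ℂ H) (a : ι → ℝ)
    (σ : H →L[ℂ] H) : ofBounded σ = expNeg (diagOp b fun i => (a i : ℂ)) ↔
      ∀ i, σ (b i) = (Real.exp (-a i) : ℂ) • b i := by
  rw [expNeg, spectralFun_diagOp, ofBounded_eq_diagOp_iff]

theorem mem_densityOps_diag_iff {ι : Type*} (b : HilbertBasis ι ℂ H) {a : ι → ℝ} {σ : H →L[ℂ] H}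
    (h : ∀ i, σ (b i) = (Real.exp (-a i) : ℂ) • b i) :
    σ ∈ densityOps H ↔ HasSum (fun i => Real.exp (-a i)) 1 := by
  have h0 : ∀ i, 0 ≤ Real.exp (-a i) := fun i => (Real.exp_pos _).le
  have h1 : σ ∈ densityOps H ↔ posTrace σ = 1 :=
    ⟨fun h' => h'.2, fun h' => ⟨diag_nonneg b h h0, h'⟩⟩
  rw [h1, posTrace_diag b h h0]
  constructor
  · intro h2
    have h3 : Summable fun i => Real.exp (-a i) :=
      summable_of_tsum_ofReal_lt_top h0 (by rw [h2]; exact ENNReal.one_lt_top)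
    rw [← ENNReal.ofReal_tsum_of_nonneg h0 h3, ENNReal.ofReal_eq_one] at h2
    exact h2 ▸ h3.hasSum
  · intro h2
    rw [← ENNReal.ofReal_tsum_of_nonneg h0 h2.summable, h2.tsum_eq, ENNReal.ofReal_one]

/-- If `H₀ + Ψ₀` is diagonal in `b` and `H₀ + Ψ₀ + X` is diagonal in `c`, then the states of the
form `exp (-H₀ - X - Ψ)` are the normalized exponentials in the basis `c`. -/
theorem isPerturbedState_iff {κ : Type*} {H₀ : H →ₗ.[ℂ] H} {X : H →L[ℂ] H} {Ψ₀ : ℝ}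
    {c : HilbertBasis κ ℂ H} {d : κ → ℝ}
    (h : ((X : H →ₗ[ℂ] H) +ᵥ ((((Ψ₀ : ℂ) • 1 : H →L[ℂ] H) : H →ₗ[ℂ] H) +ᵥ H₀)) =
      diagOp c fun j => (d j : ℂ)) (σ : H →L[ℂ] H) :
    IsPerturbedState H₀ X σ ↔ ∃ s : ℝ, HasSum (fun j => Real.exp (-(d j + s))) 1 ∧
      ∀ j, σ (c j) = (Real.exp (-(d j + s)) : ℂ) • c j := by
  have hop : ∀ s : ℝ, (((X + ((s + Ψ₀ : ℝ) : ℂ) • 1 : H →L[ℂ] H) : H →ₗ[ℂ] H) +ᵥ H₀) =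
      diagOp c fun j => ((d j + s : ℝ) : ℂ) := by
    intro s
    rw [Complex.ofReal_add, vadd_add_smul_one, h, vadd_smul_one_diagOp]
    simp
  constructor
  · rintro ⟨hσ, Ψ, hΨ⟩
    have h1 := hop (Ψ - Ψ₀)
    rw [sub_add_cancel] at h1
    rw [h1, ofBounded_eq_expNeg_diagOp_iff] at hΨ
    exact ⟨Ψ - Ψ₀, (mem_densityOps_diag_iff c hΨ).1 hσ, hΨ⟩
  · rintro ⟨s, hs, hσ⟩
    refine ⟨(mem_densityOps_diag_iff c hσ).2 hs, s + Ψ₀, ?_⟩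
    rw [hop, ofBounded_eq_expNeg_diagOp_iff]
    exact hσ

theorem existsUnique_isPerturbedState [Nontrivial H] {κ : Type*} {H₀ : H →ₗ.[ℂ] H}
    {X : H →L[ℂ] H} {Ψ₀ : ℝ} {c : HilbertBasis κ ℂ H} {d : κ → ℝ}
    (h : ((X : H →ₗ[ℂ] H) +ᵥ ((((Ψ₀ : ℂ) • 1 : H →L[ℂ] H) : H →ₗ[ℂ] H) +ᵥ H₀)) =
      diagOp c fun j => (d j : ℂ)) (hd : Summable fun j => Real.exp (-d j)) :
    ∃! σ : H →L[ℂ] H, IsPerturbedState H₀ X σ := by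
  have hne : Nonempty κ := by
    by_contra hcon
    rw [not_nonempty_iff] at hcon
    obtain ⟨x, hx⟩ := exists_ne (0 : H)
    apply hx
    apply c.repr.injective
    ext i
    exact hcon.elim i
  have hZ : 0 < ∑' j, Real.exp (-d j) :=
    hd.tsum_pos (fun j => (Real.exp_pos _).le) hne.some (Real.exp_pos _)
  have hexp : ∀ s j, Real.exp (-(d j + s)) = Real.exp (-d j) * Real.exp (-s) := by
    intro s j; rw [← Real.exp_add]; ring_nf
  -- The normalizing constant must be the logarithm of the partition function; this gives existence
  -- and uniqueness at once.
  have hiff : ∀ s, HasSum (fun j => Real.exp (-(d j + s))) 1 ↔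
      s = Real.log (∑' j, Real.exp (-d j)) := by
    intro s
    have h1 : HasSum (fun j => Real.exp (-(d j + s))) ((∑' j, Real.exp (-d j)) * Real.exp (-s)) :=
      (hasSum_congr fun j => hexp s j).2 (hd.hasSum.mul_right _)
    have h2 : HasSum (fun j => Real.exp (-(d j + s))) 1 ↔
        (∑' j, Real.exp (-d j)) * Real.exp (-s) = 1 :=
      ⟨fun h2 => h1.unique h2, fun h2 => h2 ▸ h1⟩
    rw [h2, Real.exp_neg, mul_inv_eq_one₀ (Real.exp_pos s).ne']
    constructor
    · intro h3; rw [h3, Real.log_exp]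
    · intro h3; rw [h3, Real.exp_log hZ]
  obtain ⟨σ, hσ, -⟩ := exists_diag c
    (fun j => (Real.exp (-(d j + Real.log (∑' j, Real.exp (-d j)))) : ℂ)) zero_le_one (by
      intro j
      rw [Complex.norm_real, Real.norm_of_nonneg (Real.exp_pos _).le]
      exact le_hasSum ((hiff _).2 rfl) j fun _ _ => (Real.exp_pos _).le)
  refine ⟨σ, (isPerturbedState_iff h σ).2 ⟨_, (hiff _).2 rfl, hσ⟩, fun τ hτ => ?_⟩
  obtain ⟨s, hs, hτc⟩ := (isPerturbedState_iff h τ).1 hτ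
  rw [(hiff s).1 hs] at hτc
  exact diag_ext c hτc hσ

/-! ### Membership in the manifold and the main theorem -/

theorem mem_infoManifold_diag_iff {ι : Type*} (b : HilbertBasis ι ℂ H) {a : ι → ℝ}
    {σ : H →L[ℂ] H} (h : ∀ i, σ (b i) = (Real.exp (-a i) : ℂ) • b i) :
    σ ∈ infoManifold H ↔ (∃ p ∈ Set.Ioo (0 : ℝ) 1,
      ∑' i, ENNReal.ofReal (Real.exp (-(p * a i))) < ∞) ∧ σ ∈ densityOps H := by
  unfold infoManifold
  rw [Set.mem_inter_iff, Set.mem_iUnion₂]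
  refine and_congr_left fun _ => exists_congr fun p => ?_
  rw [exists_prop]
  refine and_congr_right fun hp => ?_
  rw [mem_schattenClass_diag_iff b h (fun i => (Real.exp_pos _).le) hp.1]
  have : ∀ i, Real.exp (-a i) ^ p = Real.exp (-(p * a i)) := by
    intro i; rw [← Real.exp_mul]; ring_nf
  simp only [this]

theorem tendsto_atTop_of_summable_exp_neg {ι : Type*} {a : ι → ℝ}
    (h : Summable fun i => Real.exp (-a i)) : Tendsto a cofinite atTop := by
  have h1 := h.tendsto_cofinite_zero
  rw [Real.tendsto_exp_comp_nhds_zero] at h1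
  exact tendsto_neg_atBot_iff.1 h1

end QInfo

open QInfo in
theorem mainTheorem5 {H : Type*} [NormedAddCommGroup H] [InnerProductSpace ℂ H] [CompleteSpace H]
    [TopologicalSpace.SeparableSpace H]
    (H₀ : H →ₗ.[ℂ] H) (ρ : H →L[ℂ] H) (hρ : ρ ∈ QInfo.infoManifold H)
    (hρ₀ : QInfo.IsPerturbedState H₀ 0 ρ)
    (X : H →L[ℂ] H) (hX : IsSelfAdjoint X) :
    (∃! σ : H →L[ℂ] H, QInfo.IsPerturbedState H₀ X σ) ∧
      ∀ σ : H →L[ℂ] H, QInfo.IsPerturbedState H₀ X σ →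
        σ ∈ QInfo.infoManifold H ∧
        QInfo.traceNorm (ρ - σ) ≤ ‖X‖ₑ ∧
        ‖X‖ₑ ≤ QInfo.arakiNorm ρ X := by
  obtain ⟨hdens, Ψ₀, hΨ₀⟩ := hρ₀
  have := nontrivial_of_mem_densityOps hdens
  obtain ⟨w, b, a, hb⟩ := exists_diagOp_of_ofBounded_eq_expNeg hΨ₀
  rw [hb, ofBounded_eq_expNeg_diagOp_iff] at hΨ₀
  rw [zero_add] at hb
  have hp := (mem_densityOps_diag_iff b hΨ₀).1 hdens
  obtain ⟨κ, c, d, hc⟩ := exists_diagOp_eq_vadd b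
    (tendsto_atTop_of_summable_exp_neg hp.summable) hX
  have hrel := eigenvalue_sub_mul_inner hc
  have hpeierls := fun t ht => tsum_exp_neg_le hrel (t := t) ht
  rw [← hb] at hc
  obtain ⟨⟨p, hp01, hpsum⟩, -⟩ := (mem_infoManifold_diag_iff b hΨ₀).1 hρ
  -- Peierls at `t = 1`: `exp (-(A + X))` is of trace class.
  have hd : Summable fun j => Real.exp (-d j) := by
    have h1 := hpeierls 1 zero_le_one
    simp only [one_mul] at h1
    have h2 := hp.summable.tsum_ofReal_lt_top
    exact summable_of_tsum_ofReal_lt_top (fun _ => (Real.exp_pos _).le)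
      ((h1 h2).trans_lt (ENNReal.mul_lt_top ENNReal.ofReal_lt_top h2))
  refine ⟨existsUnique_isPerturbedState hc hd, fun σ hσ => ⟨?_, ?_, enorm_le_arakiNorm b hΨ₀ X⟩⟩
  · obtain ⟨s, hs, hσc⟩ := (isPerturbedState_iff hc σ).1 hσ
    refine (mem_infoManifold_diag_iff c hσc).2 ⟨⟨p, hp01, ?_⟩, hσ.1⟩
    -- Peierls at the exponent `p` of `ρ`; normalization only contributes the factor `exp (-(p *
    -- s))`.
    have h1 := (hpeierls p hp01.1.le hpsum).trans_lt
      (ENNReal.mul_lt_top ENNReal.ofReal_lt_top hpsum)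
    have h2 : ∀ j, ENNReal.ofReal (Real.exp (-(p * (d j + s)))) =
        ENNReal.ofReal (Real.exp (-(p * s))) * ENNReal.ofReal (Real.exp (-(p * d j))) := by
      intro j
      rw [← ENNReal.ofReal_mul (Real.exp_pos _).le, ← Real.exp_add]
      ring_nf
    simp only [h2]
    rw [ENNReal.tsum_mul_left]
    exact ENNReal.mul_lt_top ENNReal.ofReal_lt_top h1
  · obtain ⟨s, hs, hσc⟩ := (isPerturbedState_iff hc σ).1 hσ
    refine traceNorm_sub_le hp hs hΨ₀ hσc hX (t := s) fun i j => ?_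
    have h1 := hrel i j
    have h2 : ⟪b i, (X + (s : ℂ) • 1 : H →L[ℂ] H) (c j)⟫_ℂ =
        ⟪b i, X (c j)⟫_ℂ + s * ⟪b i, c j⟫_ℂ := by
      simp
    rw [h2, ← h1]
    push_cast
    ring
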